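/- Let $1\le p\le\infty$, let $X$ be a (real or complex) Banach space, and suppose there is a sequence of compact linear operators $K_n\colon X\to X$ such that (a) $K_nx\to x$ for all $x\in X$, (b) $K_n^*x^*\to x^*$ in norm for all $x^*\in X^*$, (c) $\|\mathrm{Id}_X-2K_n\|\to 1$. Let $Y$ be a Banach space over the same scalar field. Let $L(X,Y)$ be the space of bounded linear operators from $X$ to $Y$ with the operator norm and $K(X,Y)$ its subspace of compact operators. Then $K(X,Y)$ is an $M$-ideal in $L(X,Y)$ if and only if every $T\in L(X,Y)$ with $\|T\|\le 1$ has the $p$-averaged property $(M)$. Here a closed subspace $J$ of a Banach space $E$ is called an $M$-ideal in $E$ if there is a closed subspace $V$ of $E^*$ such that $E^*=J^\perp\oplus V$ and $\|f+g\|=\|f\|+\|g\|$ for all $f\in J^\perp$, $g\in V$, where $J^\perp=\{f\in E^*: f|_J=0\}$. An operator $T\in L(X,Y)$ has the $p$-averaged property $(M)$ if, for all $x\in X$ and $y\in Y$ with $\|y\|\le\|x\|$ and every sequence $(x_n)$ in $X$ converging weakly to $0$, $$\limsup_{n}\|y+Tx_n\|\le\limsup_{n}\left(\frac{\|x+x_n\|^p+\|x-x_n\|^p}{2}\right)^{1/p}\quad\text{if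 } p<\infty,$$ $$\limsup_{n}\|y+Tx_n\|\le\limsup_{n}\max(\|x+x_n\|,\|x-x_n\|)\quad\text{if } p=\infty.$$ -/

import Mathlib

open Filter Topology
open scoped ENNReal

/-- A closed subspace `J` of `E` is an `M`-ideal if the dual of `E` is the `ℓ₁`-direct sum of the
annihilator of `J` and some closed subspace `V`. The polar of a subspace is its annihilator
`{f | ∀ x ∈ J, f x = 0}`. -/
def IsMIdeal {𝕜 E : Type*} [RCLike 𝕜] [NormedAddCommGroup E] [NormedSpace 𝕜 E]
    (J : Submodule 𝕜 E) : Prop :=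
  IsClosed (J : Set E) ∧
    ∃ V : Submodule 𝕜 (StrongDual 𝕜 E),
      IsClosed (V : Set (StrongDual 𝕜 E)) ∧
      IsCompl (StrongDual.polarSubmodule 𝕜 J) V ∧
      ∀ f ∈ StrongDual.polarSubmodule 𝕜 J, ∀ g ∈ V, ‖f + g‖ = ‖f‖ + ‖g‖

/-- `x n → 0` weakly. -/
def WeaklyNull (𝕜 : Type*) {X : Type*} [RCLike 𝕜] [NormedAddCommGroup X] [NormedSpace 𝕜 X]
    (x : ℕ → X) : Prop :=
  ∀ f : StrongDual 𝕜 X, Tendsto (fun n => f (x n)) atTop (𝓝 0)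

/-- The `p`-average `((a ^ p + b ^ p) / 2) ^ (1 / p)` of two nonnegative reals, which is
`max a b` for `p = ∞`. -/
noncomputable def pAverage (p : ℝ≥0∞) (a b : ℝ) : ℝ :=
  if p = ∞ then max a b else ((a ^ p.toReal + b ^ p.toReal) / 2) ^ (1 / p.toReal)

/-- The `p`-averaged property `(M)` of an operator `T : X → Y`. Weakly null sequences are
bounded, so that both upper limits are upper limits of bounded real sequences. -/
def HasAveragedM {𝕜 X Y : Type*} [RCLike 𝕜] [NormedAddCommGroup X] [NormedSpace 𝕜 X]
    [NormedAddCommGroup Y] [NormedSpace 𝕜 Y] (p : ℝ≥0∞) (T : X →L[𝕜] Y) : Prop :=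
  ∀ (x : X) (y : Y), ‖y‖ ≤ ‖x‖ → ∀ u : ℕ → X, WeaklyNull 𝕜 u →
    limsup (fun n => ‖y + T (u n)‖) atTop ≤
      limsup (fun n => pAverage p ‖x + u n‖ ‖x - u n‖) atTop

/-! Write `J` for the compact operators. If `J` is an M-ideal, functionals `T ↦ f (T x)` lie in `V`,
and Hahn–Banach gives, for contractions `S ∈ J` and `T`, some `H ∈ J` with `‖S + T - H‖ < 1 + ε` and
`‖(T - H) x‖ < ε` (`exists_mem_norm_add_sub_lt`). For `S` of rank one with `S x = y`, evaluation at
`x + u n` bounds `‖y + T (u n)‖` by `‖x + u n‖` up to small errors. Replacing `T`, `u` by `-T`, `-u`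
gives `‖x - u n‖`, hence any average of the two.

Conversely, `V` consists of the functionals with `g (T ∘L K n) → g T` along an ultrafilter. Norm
additivity follows from `‖S ∘L K m + T - T ∘L K n‖ ≲ (1 + ‖Id - 2 K m‖) / 2` for large `n`
(`eventually_norm_comp_add_comp_le`), where the averaged property is applied at `z = lim K m (v k)`.
There both `‖z + u k‖` and `‖z - u k‖` are controlled by (c), so `p` is immaterial. -/

section PAverage

/-- With `le_pAverage`, this is all the argument needs about `p`: the average lies between the
minimum and the maximum. -/
theorem pAverage_le {p : ℝ≥0∞} (hp : 1 ≤ p) {a b c : ℝ} (ha : 0 ≤ a) (hb : 0 ≤ b)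
    (hac : a ≤ c) (hbc : b ≤ c) : pAverage p a b ≤ c := by
  unfold pAverage
  split_ifs with h
  · exact max_le hac hbc
  · have hq : 0 < p.toReal := ENNReal.toReal_pos (zero_lt_one.trans_le hp).ne' h
    have h1 := Real.rpow_le_rpow ha hac hq.le
    have h2 := Real.rpow_le_rpow hb hbc hq.le
    have h3 := Real.rpow_nonneg ha p.toReal
    have h4 := Real.rpow_nonneg hb p.toReal
    rw [one_div, Real.rpow_inv_le_iff_of_pos (by positivity) (ha.trans hac) hq]
    linarith

theorem le_pAverage {p : ℝ≥0∞} (hp : 1 ≤ p) {a b c : ℝ} (hc : 0 ≤ c)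
    (hca : c ≤ a) (hcb : c ≤ b) : c ≤ pAverage p a b := by
  unfold pAverage
  split_ifs with h
  · exact hca.trans (le_max_left _ _)
  · have hq : 0 < p.toReal := ENNReal.toReal_pos (zero_lt_one.trans_le hp).ne' h
    have h1 := Real.rpow_le_rpow hc hca hq.le
    have h2 := Real.rpow_le_rpow hc hcb hq.le
    have h3 := Real.rpow_nonneg hc p.toReal
    rw [one_div, Real.le_rpow_inv_iff_of_pos hc (by linarith) hq]
    linarith

end PAverage

/-! ### Weakly null sequences and compact operators. -/

section WeaklyNull

variable {𝕜 X Y : Type*} [RCLike 𝕜] [NormedAddCommGroup X] [NormedSpace 𝕜 X]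
  [NormedAddCommGroup Y] [NormedSpace 𝕜 Y]

theorem WeaklyNull.exists_norm_le {u : ℕ → X} (hu : WeaklyNull 𝕜 u) : ∃ C, ∀ n, ‖u n‖ ≤ C := by
  obtain ⟨C, hC⟩ := banach_steinhaus (g := fun n => NormedSpace.inclusionInDoubleDualLi 𝕜 (u n))
    fun f => by
      obtain ⟨C, hC⟩ := (hu f).norm.bddAbove_range
      exact ⟨C, fun n => hC ⟨n, rfl⟩⟩
  exact ⟨C, fun n => by
    simpa only [LinearIsometry.norm_map] using hC n⟩

/-- Compact operators are completely continuous on weakly null sequences. -/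
theorem IsCompactOperator.tendsto_of_weaklyNull {T : X →L[𝕜] Y} (hT : IsCompactOperator T)
    {u : ℕ → X} (hu : WeaklyNull 𝕜 u) : Tendsto (fun n => T (u n)) atTop (𝓝 0) := by
  obtain ⟨C, hC⟩ := hu.exists_norm_le
  obtain ⟨s, hs, hTs⟩ := hT.image_closedBall_subset_compact (f := (T : X →ₗ[𝕜] Y)) C
  refine tendsto_of_subseq_tendsto fun ns hns => ?_
  obtain ⟨z, -, φ, hφ, hz⟩ := hs.tendsto_subseq (x := fun n => T (u (ns n)))
    fun n => hTs ⟨u (ns n), by simpa using hC (ns n), rfl⟩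
  refine ⟨φ, ?_⟩
  have : z = 0 := SeparatingDual.eq_zero_of_forall_dual_eq_zero (R := 𝕜) fun f =>
    tendsto_nhds_unique ((f.continuous.tendsto z).comp hz)
      ((hu (f ∘L T)).comp (hns.comp hφ.tendsto_atTop))
  exact this ▸ hz

theorem isCompactOperator_smulRight (f : StrongDual 𝕜 X) (y : Y) :
    IsCompactOperator (f.smulRight y) := by
  have h : IsCompactOperator f := isCompactOperator_of_locallyCompactSpace_dom f
  exact h.clm_comp (ContinuousLinearMap.toSpanSingleton 𝕜 y)

end WeaklyNull

/-! ### M-ideals in general normed spaces. -/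

section MIdeal

variable {𝕜 E F : Type*} [RCLike 𝕜] [NormedAddCommGroup E] [NormedSpace 𝕜 E]
  [NormedAddCommGroup F] [NormedSpace 𝕜 F]

theorem StrongDual.norm_le_of_re_le (φ : StrongDual 𝕜 E) {r C : ℝ} (hr : 0 < r)
    (h : ∀ x, ‖x‖ < r → RCLike.re (φ x) ≤ C) : r * ‖φ‖ ≤ C := by
  rw [← le_div_iff₀' hr]
  refine le_of_forall_lt fun a ha => ?_
  obtain ⟨x, hx, hax⟩ := φ.exists_lt_apply_of_lt_opNorm ha
  obtain ⟨c, hc, hcx⟩ := RCLike.exists_norm_eq_mul_self (φ x)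
  rw [lt_div_iff₀' hr]
  have hlt : ‖((r : 𝕜) * c) • x‖ < r := by
    rw [norm_smul, norm_mul, hc, RCLike.norm_of_nonneg hr.le]
    nlinarith
  have := h _ hlt
  rw [map_smul, smul_eq_mul, mul_assoc, ← hcx, ← RCLike.ofReal_mul, RCLike.ofReal_re] at this
  nlinarith

/-- `S` and `T` vary independently, so both functionals can be made nearly norming with values of
the same phase. -/
theorem StrongDual.norm_add_norm_le {f g : StrongDual 𝕜 E} {C : ℝ}
    (h : ∀ S T : E, ‖S‖ ≤ 1 → ‖T‖ ≤ 1 → ‖f T + g S‖ ≤ C) : ‖f‖ + ‖g‖ ≤ C := by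
  have hf : ∀ T, ‖T‖ < 1 → RCLike.re (f T) ≤ C - ‖g‖ := fun T hT => by
    have := g.norm_le_of_re_le one_pos (C := C - RCLike.re (f T)) fun S hS => by
      have h1 := (RCLike.re_le_norm _).trans (h S T hS.le hT.le)
      rw [map_add] at h1
      linarith
    linarith
  have := f.norm_le_of_re_le one_pos hf
  linarith

/-- A functional whose norm is attained on `J` belongs to the complement of the annihilator. -/
theorem mem_of_norm_le_on {J : Submodule 𝕜 E} {V : Submodule 𝕜 (StrongDual 𝕜 E)}
    (hV : IsCompl (StrongDual.polarSubmodule 𝕜 J) V)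
    (hn : ∀ f ∈ StrongDual.polarSubmodule 𝕜 J, ∀ g ∈ V, ‖f + g‖ = ‖f‖ + ‖g‖)
    {φ : StrongDual 𝕜 E} (hφ : ∀ C, 0 ≤ C → (∀ x ∈ J, ‖φ x‖ ≤ C * ‖x‖) → ‖φ‖ ≤ C) : φ ∈ V := by
  obtain ⟨f, hf, g, hg, rfl⟩ := Submodule.mem_sup.1 (hV.sup_eq_top ▸ Submodule.mem_top (x := φ))
  -- On `J` the functional agrees with `g`, so `‖f + g‖ ≤ ‖g‖`, and additivity forces `f = 0`.
  have h := hφ ‖g‖ (norm_nonneg _) fun x hx => by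
    rw [StrongDual.mem_polarSubmodule] at hf
    simpa [hf x hx] using g.le_opNorm x
  rw [hn f hf g hg] at h
  have : f = 0 := norm_le_zero_iff.1 (by linarith)
  simpa [this] using hg

/-- Otherwise an open product of balls is separated from the pairs `(S + T - H, A (T - H))`. The
separating functional yields `φ` and `ψ ∈ V` with `φ + ψ` in the annihilator, so `‖φ‖ = ‖φ + ψ‖ +
‖ψ‖`; this bounds the separation level by `‖φ‖`, whereas the ball of radius `1 + ε` forces it to be
at least `(1 + ε) * ‖φ‖`. -/
theorem exists_mem_norm_add_sub_lt {J : Submodule 𝕜 E} {V : Submodule 𝕜 (StrongDual 𝕜 E)}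
    (hn : ∀ f ∈ StrongDual.polarSubmodule 𝕜 J, ∀ g ∈ V, ‖f + g‖ = ‖f‖ + ‖g‖)
    (A : E →L[𝕜] F) (hA : ∀ f : StrongDual 𝕜 F, f ∘L A ∈ V)
    {S T : E} (hS : S ∈ J) (hS1 : ‖S‖ ≤ 1) (hT1 : ‖T‖ ≤ 1) {ε : ℝ} (hε : 0 < ε) :
    ∃ H ∈ J, ‖S + T - H‖ < 1 + ε ∧ ‖A (T - H)‖ < ε := by
  by_contra! hcon
  let _ : NormedSpace ℝ E := NormedSpace.restrictScalars ℝ 𝕜 E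
  let _ : NormedSpace ℝ F := NormedSpace.restrictScalars ℝ 𝕜 F
  have : IsScalarTower ℝ 𝕜 E := inferInstance
  have : IsScalarTower ℝ 𝕜 F := inferInstance
  set s : Set (E × F) := Metric.ball 0 (1 + ε) ×ˢ Metric.ball 0 ε with hs
  set t : Set (E × F) := (fun H => (S + T - H, A (T - H))) '' (J : Set E) with ht
  have hconv : Convex ℝ t := by
    rintro _ ⟨H, hH, rfl⟩ _ ⟨H', hH', rfl⟩ a b ha hb hab
    have hb' : b = 1 - a := by linarith
    refine ⟨a • H + b • H', J.add_mem (J.smul_of_tower_mem a hH) (J.smul_of_tower_mem b hH'), ?_⟩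
    have hAs (c : ℝ) (v : E) : A (c • v) = c • A v := (A.restrictScalars ℝ).map_smul c v
    ext
    · simp only [Prod.fst_add, Prod.smul_fst, hb']
      module
    · simp only [Prod.snd_add, Prod.smul_snd, hb', map_sub, map_add, hAs]
      module
  have hdisj : Disjoint s t := by
    rw [Set.disjoint_left]
    rintro _ ⟨h1, h2⟩ ⟨H, hH, rfl⟩
    simp only [mem_ball_zero_iff] at h1 h2
    exact (hcon H hH h1).not_gt h2
  obtain ⟨Φ, u, hu, hv⟩ := RCLike.geometric_hahn_banach_open (𝕜 := 𝕜) (s := s) (t := t)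
    ((convex_ball _ _).prod (convex_ball _ _)) (Metric.isOpen_ball.prod Metric.isOpen_ball)
    hconv hdisj
  set φ : StrongDual 𝕜 E := Φ ∘L ContinuousLinearMap.inl 𝕜 E F with hφ
  set ψ : StrongDual 𝕜 E := (Φ ∘L ContinuousLinearMap.inr 𝕜 E F) ∘L A with hψ
  have hΦ (e : E) (v : E) : Φ (e, A v) = φ e + ψ v := by
    simp [hφ, hψ, ← map_add]
  have hval : ∀ H ∈ J, u ≤ RCLike.re (φ (S + T) + ψ T) - RCLike.re ((φ + ψ) H) := by
    intro H hH
    have := hv _ ⟨H, hH, rfl⟩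
    rw [hΦ] at this
    simp only [map_add, map_sub, add_apply] at this ⊢
    linarith
  have hf : φ + ψ ∈ StrongDual.polarSubmodule 𝕜 J := by
    rw [StrongDual.mem_polarSubmodule]
    intro H hH
    by_contra hne
    -- Scaling `H` so that `φ + ψ` takes the value `c` turns `hval` into `u ≤ u - 1`.
    set c := (RCLike.re (φ (S + T) + ψ T) - u + 1 : ℝ)
    have := hval (((c : 𝕜) / (φ + ψ) H) • H) (J.smul_mem _ hH)
    rw [map_smul, smul_eq_mul, div_mul_cancel₀ _ hne, RCLike.ofReal_re] at this
    simp only [c] at this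
    linarith
  have hnorm : ‖φ‖ = ‖φ + ψ‖ + ‖ψ‖ := by
    simpa using hn _ hf (-ψ) (V.neg_mem (hA _))
  have hu1 : u ≤ ‖φ‖ := by
    have h1 := hval 0 J.zero_mem
    have h2 : φ (S + T) + ψ T = (φ + ψ) T - ψ S := by
      have := (StrongDual.mem_polarSubmodule _ _ _).1 hf S hS
      simp only [add_apply, map_add] at this ⊢
      linear_combination this
    have h3 : ‖(φ + ψ) T - ψ S‖ ≤ ‖φ + ψ‖ + ‖ψ‖ :=
      (norm_sub_le _ _).trans (add_le_add ((φ + ψ).unit_le_opNorm T hT1) (ψ.unit_le_opNorm S hS1))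
    have h4 := RCLike.re_le_norm ((φ + ψ) T - ψ S)
    rw [h2] at h1
    simp only [map_zero, sub_zero] at h1
    linarith
  have h0 : 0 < u := by
    simpa using hu 0 ⟨by simp; linarith, by simpa⟩
  have h5 := φ.norm_le_of_re_le (r := 1 + ε) (C := u) (by linarith) fun x hx => by
    have := hu (x, 0) ⟨by simpa, by simpa⟩
    simpa [hφ] using this.le
  nlinarith

end MIdeal

/-! ### From M-ideal to the averaged property. -/

section Necessity

variable {𝕜 X Y : Type*} [RCLike 𝕜] [NormedAddCommGroup X] [NormedSpace 𝕜 X]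
  [NormedAddCommGroup Y] [NormedSpace 𝕜 Y]

/-- Rank-one operators suffice: with `g` norming `x`, `g.smulRight (T x)` sends `x` to `‖x‖ • T x`
and has norm at most `‖T‖ * ‖x‖`. -/
theorem norm_comp_apply_le_of_compactOperator (x : X) (f : StrongDual 𝕜 Y) {C : ℝ} (hC : 0 ≤ C)
    (h : ∀ T ∈ compactOperator (RingHom.id 𝕜) X Y,
      ‖(f ∘L ContinuousLinearMap.apply 𝕜 Y x) T‖ ≤ C * ‖T‖) :
    ‖f ∘L ContinuousLinearMap.apply 𝕜 Y x‖ ≤ C := by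
  refine ContinuousLinearMap.opNorm_le_bound _ hC fun T => ?_
  rcases eq_or_ne x 0 with rfl | hx
  · simpa using by positivity
  obtain ⟨g, hg, hgx⟩ := exists_dual_vector 𝕜 x (norm_ne_zero_iff.2 hx)
  have h1 := h (g.smulRight (T x)) (isCompactOperator_smulRight g (T x))
  have h2 : ‖g.smulRight (T x)‖ ≤ ‖T‖ * ‖x‖ := by
    simpa [hg] using T.le_opNorm x
  have h3 : 0 < ‖x‖ := norm_pos_iff.2 hx
  simp only [ContinuousLinearMap.comp_apply, ContinuousLinearMap.apply_apply,
    ContinuousLinearMap.smulRight_apply, hgx, map_smul, norm_smul, RCLike.norm_ofReal,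
    abs_norm] at h1 ⊢
  refine le_of_mul_le_mul_left ?_ h3
  calc ‖x‖ * ‖f (T x)‖ ≤ C * ‖g.smulRight (T x)‖ := h1
    _ ≤ C * (‖T‖ * ‖x‖) := by gcongr
    _ = ‖x‖ * (C * ‖T‖) := by ring

/-- If `K(X, Y)` is an `M`-ideal then every contraction has property `(M)`. -/
theorem IsMIdeal.eventually_norm_add_le (hM : IsMIdeal (compactOperator (RingHom.id 𝕜) X Y))
    {T : X →L[𝕜] Y} (hT : ‖T‖ ≤ 1) {x : X} {y : Y} (hxy : ‖y‖ ≤ ‖x‖) {u : ℕ → X}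
    (hu : WeaklyNull 𝕜 u) {ε : ℝ} (hε : 0 < ε) :
    ∀ᶠ n in atTop, ‖y + T (u n)‖ ≤ (1 + ε) * ‖x + u n‖ + 2 * ε := by
  obtain ⟨-, V, -, hV, hn⟩ := hM
  obtain ⟨S, hS, hS1, hSx⟩ : ∃ S ∈ compactOperator (RingHom.id 𝕜) X Y, ‖S‖ ≤ 1 ∧ S x = y := by
    rcases eq_or_ne x 0 with rfl | hx
    · exact ⟨0, Submodule.zero_mem _, by simp, by simpa [eq_comm] using hxy⟩
    obtain ⟨g, hg, hgx⟩ := exists_dual_vector 𝕜 x (norm_ne_zero_iff.2 hx)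
    have h3 : 0 < ‖x‖ := norm_pos_iff.2 hx
    refine ⟨g.smulRight (((‖x‖⁻¹ : ℝ) : 𝕜) • y), isCompactOperator_smulRight _ _, ?_, ?_⟩
    · rw [ContinuousLinearMap.norm_smulRight_apply, hg, norm_smul, RCLike.norm_ofReal, abs_inv,
        abs_norm, one_mul]
      exact inv_mul_le_one_of_le₀ hxy h3.le
    · rw [ContinuousLinearMap.smulRight_apply, hgx, smul_smul, ← RCLike.ofReal_mul,
        mul_inv_cancel₀ h3.ne', RCLike.ofReal_one, one_smul]
  obtain ⟨H, hH, h1, h2⟩ := exists_mem_norm_add_sub_lt hn (ContinuousLinearMap.apply 𝕜 Y x)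
    (fun f => mem_of_norm_le_on hV hn fun _ => norm_comp_apply_le_of_compactOperator x f)
    hS hS1 hT hε
  have hlim : Tendsto (fun n => ‖(H - S) (u n)‖) atTop (𝓝 0) := by
    have : IsCompactOperator (H - S) := IsCompactOperator.sub hH hS
    simpa using (this.tendsto_of_weaklyNull hu).norm
  filter_upwards [hlim.eventually_lt_const hε] with n hlt
  have hid : y + T (u n) = (S + T - H) (x + u n) - (T - H) x + (H - S) (u n) := by
    simp only [← hSx, map_add, add_apply, sub_apply]
    abel
  have h4 : ‖(S + T - H) (x + u n)‖ ≤ (1 + ε) * ‖x + u n‖ :=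
    (S + T - H).le_of_opNorm_le h1.le _
  have h5 : ‖(T - H) x‖ < ε := h2
  rw [hid]
  refine (norm_add_le _ _).trans ?_
  have := norm_sub_le ((S + T - H) (x + u n)) ((T - H) x)
  linarith

theorem IsMIdeal.hasAveragedM (hM : IsMIdeal (compactOperator (RingHom.id 𝕜) X Y))
    {p : ℝ≥0∞} (hp : 1 ≤ p) {T : X →L[𝕜] Y} (hT : ‖T‖ ≤ 1) : HasAveragedM p T := by
  intro x y hxy u hu
  obtain ⟨C, hC⟩ := hu.exists_norm_le
  set a : ℕ → ℝ := fun n => pAverage p ‖x + u n‖ ‖x - u n‖ with ha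
  have ha0 (n : ℕ) : 0 ≤ a n := le_pAverage hp le_rfl (norm_nonneg _) (norm_nonneg _)
  have hbdd : IsBoundedUnder (· ≤ ·) atTop a := isBoundedUnder_of ⟨‖x‖ + C, fun n =>
    pAverage_le hp (norm_nonneg _) (norm_nonneg _)
      ((norm_add_le _ _).trans (by gcongr; exact hC n))
      ((norm_sub_le _ _).trans (by gcongr; exact hC n))⟩
  have hle {ε : ℝ} (hε : 0 < ε) :
      limsup (fun n => ‖y + T (u n)‖) atTop ≤ (1 + ε) * (limsup a atTop + ε) + 2 * ε := by
    refine limsup_le_of_le (isCoboundedUnder_le_of_le atTop (x := 0) fun n => norm_nonneg _) ?_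
    -- Passing to `-T` and `-u` leaves `y + T (u n)` unchanged and turns `x + u n` into `x - u n`.
    have hu' : WeaklyNull 𝕜 (fun n => -u n) := fun f => by simpa using (hu f).neg
    filter_upwards [hM.eventually_norm_add_le hT hxy hu hε,
      hM.eventually_norm_add_le (T := -T) (by simpa) hxy hu' hε,
      eventually_lt_of_limsup_lt (lt_add_of_pos_right (limsup a atTop) hε) hbdd] with n h1 h2 h3
    simp only [neg_apply, map_neg, neg_neg, ← sub_eq_add_neg] at h2
    have h4 : (‖y + T (u n)‖ - 2 * ε) / (1 + ε) ≤ max 0 (a n) := by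
      rcases le_total ((‖y + T (u n)‖ - 2 * ε) / (1 + ε)) 0 with h | h
      · exact h.trans (le_max_left _ _)
      · refine (le_pAverage hp h ?_ ?_).trans (le_max_right _ _) <;>
        · rw [div_le_iff₀' (by linarith)]
          linarith
    rw [max_eq_right (ha0 n), div_le_iff₀' (by linarith)] at h4
    nlinarith
  have hlim : Tendsto (fun ε : ℝ => (1 + ε) * (limsup a atTop + ε) + 2 * ε) (𝓝[>] 0)
      (𝓝 (limsup a atTop)) := by
    refine tendsto_nhdsWithin_of_tendsto_nhds ?_
    have : Continuous fun ε : ℝ => (1 + ε) * (limsup a atTop + ε) + 2 * ε := by fun_prop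
    simpa using this.tendsto 0
  exact ge_of_tendsto hlim (eventually_mem_nhdsWithin.mono fun ε hε => hle hε)

end Necessity

/-! ### From the averaged property to M-ideal. -/

section Sufficiency

variable {𝕜 X Y : Type*} [RCLike 𝕜] [NormedAddCommGroup X] [NormedSpace 𝕜 X]
  [NormedAddCommGroup Y] [NormedSpace 𝕜 Y]

theorem weaklyNull_sub_apply {K : ℕ → X →L[𝕜] X}
    (hb : ∀ f : StrongDual 𝕜 X, Tendsto (fun n => f ∘L K n) atTop (𝓝 f))
    {x : ℕ → X} {C : ℝ} (hx : ∀ n, ‖x n‖ ≤ C) {φ : ℕ → ℕ} (hφ : Tendsto φ atTop atTop) :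
    WeaklyNull 𝕜 (fun k => x k - K (φ k) (x k)) := by
  intro f
  have h : Tendsto (fun k => ‖f - f ∘L K (φ k)‖ * C) atTop (𝓝 0) := by
    simpa using ((tendsto_const_nhds (x := f)).sub ((hb f).comp hφ)).norm.mul_const C
  refine squeeze_zero_norm (fun k => ?_) h
  have : f (x k - K (φ k) (x k)) = (f - f ∘L K (φ k)) (x k) := by simp
  rw [this]
  exact (f - f ∘L K (φ k)).le_opNorm_of_le (hx k)

theorem exists_norm_le_of_tendsto_norm_id_sub {K : ℕ → X →L[𝕜] X}
    (hc : Tendsto (fun n => ‖ContinuousLinearMap.id 𝕜 X - (2 : 𝕜) • K n‖) atTop (𝓝 1)) :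
    ∃ C, ∀ n, ‖K n‖ ≤ C := by
  obtain ⟨B, hB⟩ := hc.bddAbove_range
  refine ⟨(‖ContinuousLinearMap.id 𝕜 X‖ + B) / 2, fun n => ?_⟩
  have h1 : ‖(2 : 𝕜) • K n‖ ≤ ‖ContinuousLinearMap.id 𝕜 X‖ + B := by
    have := norm_sub_le (ContinuousLinearMap.id 𝕜 X) (ContinuousLinearMap.id 𝕜 X - (2 : 𝕜) • K n)
    rw [sub_sub_cancel] at this
    exact this.trans (by gcongr; exact hB ⟨n, rfl⟩)
  rw [norm_smul, RCLike.norm_ofNat] at h1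
  linarith

/-- If it fails, nearly norming vectors `v k` give `z = lim K m (v k)` and the weakly null `u k = v
k - K (ψ k) (v k)`, and the averaged property for the pair `z`, `S z` is violated. -/
theorem eventually_norm_comp_add_comp_le {p : ℝ≥0∞} (hp : 1 ≤ p)
    {K : ℕ → X →L[𝕜] X} (hK : ∀ n, IsCompactOperator (K n))
    (ha : ∀ x : X, Tendsto (fun n => K n x) atTop (𝓝 x))
    (hb : ∀ f : StrongDual 𝕜 X, Tendsto (fun n => f ∘L K n) atTop (𝓝 f))
    (hc : Tendsto (fun n => ‖ContinuousLinearMap.id 𝕜 X - (2 : 𝕜) • K n‖) atTop (𝓝 1))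
    {S T : X →L[𝕜] Y} (hS : ‖S‖ ≤ 1) (hT : HasAveragedM p T) (m : ℕ) {δ : ℝ} (hδ : 0 < δ) :
    ∀ᶠ n in atTop, ‖S ∘L K m + (T - T ∘L K n)‖ ≤
      (1 + ‖ContinuousLinearMap.id 𝕜 X - (2 : 𝕜) • K m‖) / 2 + δ := by
  set R : ℕ → X →L[𝕜] X := fun n => ContinuousLinearMap.id 𝕜 X - (2 : 𝕜) • K n with hR
  obtain ⟨C, hC⟩ := exists_norm_le_of_tendsto_norm_id_sub hc
  by_contra hcon
  rw [not_eventually] at hcon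
  simp only [not_le] at hcon
  obtain ⟨φ, hφ, hlt⟩ := extraction_of_frequently_atTop hcon
  choose x hx hxlt using fun k => ContinuousLinearMap.exists_lt_apply_of_lt_opNorm _ (hlt k)
  obtain ⟨s, hs, hKs⟩ := (hK m).image_closedBall_subset_compact (f := (K m : X →ₗ[𝕜] X)) 1
  obtain ⟨z, -, θ, hθ, hz⟩ := hs.tendsto_subseq (x := fun k => K m (x k))
    fun k => hKs ⟨x k, by simpa using (hx k).le, rfl⟩
  set ψ : ℕ → ℕ := φ ∘ θ with hψ
  have hψt : Tendsto ψ atTop atTop := hφ.tendsto_atTop.comp hθ.tendsto_atTop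
  set v : ℕ → X := x ∘ θ with hv
  have hv1 (k : ℕ) : ‖v k‖ ≤ 1 := (hx _).le
  have hz : Tendsto (fun k => K m (v k)) atTop (𝓝 z) := hz
  set u : ℕ → X := fun k => v k - K (ψ k) (v k) with hu
  have hun : WeaklyNull 𝕜 u := weaklyNull_sub_apply hb hv1 hψt
  have hlow (k : ℕ) : (1 + ‖R m‖) / 2 + δ < ‖S (K m (v k)) + T (u k)‖ := by
    simpa [hu, hv, hψ, hR] using hxlt (θ k)
  have hKz : Tendsto (fun k => K (ψ k) (K m (v k))) atTop (𝓝 z) := by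
    have h1 : Tendsto (fun k => K (ψ k) (K m (v k) - z)) atTop (𝓝 0) := by
      have h2 : Tendsto (fun k => C * ‖K m (v k) - z‖) atTop (𝓝 0) := by
        simpa using (tendsto_iff_norm_sub_tendsto_zero.1 hz).const_mul C
      exact squeeze_zero_norm (fun k => (K (ψ k)).le_of_opNorm_le (hC _) _) h2
    simpa using h1.add ((ha z).comp hψt)
  have hRψ : Tendsto (fun k => ‖R (ψ k)‖) atTop (𝓝 1) := hc.comp hψt
  have hplus : ∀ᶠ k in atTop, ‖z + u k‖ ≤ (1 + ‖R m‖) / 2 + δ / 2 := by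
    have hlim : Tendsto (fun k => (1 + ‖R (ψ k)‖ * ‖R m‖ +
        ‖(2 : 𝕜) • K m (v k) - (4 : 𝕜) • K (ψ k) (K m (v k)) + (2 : 𝕜) • z‖) / 2) atTop
        (𝓝 ((1 + ‖R m‖) / 2)) := by
      have h0 : (2 : 𝕜) • z - (4 : 𝕜) • z + (2 : 𝕜) • z = 0 := by module
      have := ((((hRψ.mul_const ‖R m‖).const_add 1).add
        (((hz.const_smul (2 : 𝕜)).sub (hKz.const_smul (4 : 𝕜))).add_const
          ((2 : 𝕜) • z)).norm).div_const 2)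
      simpa only [h0, norm_zero, add_zero, one_mul] using this
    filter_upwards [hlim.eventually_lt_const (u := (1 + ‖R m‖) / 2 + δ / 2) (by linarith)]
      with k hk
    refine le_trans ?_ hk.le
    -- Expanding `R (ψ k) (R m v)` gives `v + R (ψ k) (R m v) = 2 u - 2 K m v + 4 K (ψ k) (K m v)`,
    -- which is close to `2 (u + z)`.
    have hid : (2 : 𝕜) • (z + u k) = v k + R (ψ k) (R m (v k)) +
        ((2 : 𝕜) • K m (v k) - (4 : 𝕜) • K (ψ k) (K m (v k)) + (2 : 𝕜) • z) := by
      simp only [hR, hu, sub_apply, smul_apply, ContinuousLinearMap.id_apply, map_sub, map_smul]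
      module
    have h2 : 2 * ‖z + u k‖ = ‖(2 : 𝕜) • (z + u k)‖ := by rw [norm_smul, RCLike.norm_ofNat]
    have h3 : ‖R (ψ k) (R m (v k))‖ ≤ ‖R (ψ k)‖ * ‖R m‖ :=
      (R (ψ k)).le_opNorm_of_le ((R m).unit_le_opNorm _ (hv1 k))
    rw [le_div_iff₀' two_pos, h2, hid]
    refine (norm_add_le _ _).trans ?_
    gcongr
    exact (norm_add_le _ _).trans (add_le_add (hv1 k) h3)
  have hminus : ∀ᶠ k in atTop, ‖z - u k‖ ≤ (1 + ‖R m‖) / 2 + δ / 2 := by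
    have hlim : Tendsto (fun k => (‖R (ψ k)‖ + ‖R m‖ + ‖(2 : 𝕜) • (K m (v k) - z)‖) / 2) atTop
        (𝓝 ((1 + ‖R m‖) / 2)) := by
      have := (((hRψ.add_const ‖R m‖).add ((hz.sub_const z).const_smul (2 : 𝕜)).norm).div_const 2)
      simpa only [sub_self, smul_zero, norm_zero, add_zero] using this
    filter_upwards [hlim.eventually_lt_const (u := (1 + ‖R m‖) / 2 + δ / 2) (by linarith)]
      with k hk
    refine le_trans ?_ hk.le
    have hid : (2 : 𝕜) • (u k - z) = R (ψ k) (v k) + R m (v k) + (2 : 𝕜) • (K m (v k) - z) := by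
      simp only [hR, hu, sub_apply, smul_apply, ContinuousLinearMap.id_apply]
      module
    have h2 : 2 * ‖u k - z‖ = ‖(2 : 𝕜) • (u k - z)‖ := by rw [norm_smul, RCLike.norm_ofNat]
    rw [norm_sub_rev, le_div_iff₀' two_pos, h2, hid]
    refine (norm_add_le _ _).trans ?_
    gcongr
    exact (norm_add_le _ _).trans
      (add_le_add ((R (ψ k)).unit_le_opNorm _ (hv1 k)) ((R m).unit_le_opNorm _ (hv1 k)))
  have hupper : limsup (fun k => pAverage p ‖z + u k‖ ‖z - u k‖) atTop ≤
      (1 + ‖R m‖) / 2 + δ / 2 := by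
    refine limsup_le_of_le (isCoboundedUnder_le_of_le atTop (x := 0) fun k =>
      le_pAverage hp le_rfl (norm_nonneg _) (norm_nonneg _)) ?_
    filter_upwards [hplus, hminus] with k h1 h2
    exact pAverage_le hp (norm_nonneg _) (norm_nonneg _) h1 h2
  -- The loss `δ / 4` pays for replacing `S (K m (v k))` by `S z`; what remains still exceeds the `δ
  -- / 2` of `hupper`.
  have hlower : (1 + ‖R m‖) / 2 + 3 * δ / 4 ≤ limsup (fun k => ‖S z + T (u k)‖) atTop := by
    obtain ⟨B, hB⟩ := hun.exists_norm_le
    refine le_limsup_of_frequently_le (Eventually.frequently ?_)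
      (isBoundedUnder_of ⟨‖S z‖ + ‖T‖ * B, fun k =>
        (norm_add_le _ _).trans (by gcongr; exact T.le_opNorm_of_le (hB k))⟩)
    have hlim : Tendsto (fun k => ‖S (K m (v k)) - S z‖) atTop (𝓝 0) := by
      simpa using (((S.continuous.tendsto z).comp hz).sub_const (S z)).norm
    filter_upwards [hlim.eventually_lt_const (u := δ / 4) (by linarith)] with k hk
    have h1 : S (K m (v k)) + T (u k) = (S (K m (v k)) - S z) + (S z + T (u k)) := by abel
    have h2 := hlow k
    rw [h1] at h2
    have h3 := norm_add_le (S (K m (v k)) - S z) (S z + T (u k))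
    linarith
  have := hT z (S z) (by simpa using S.le_of_opNorm_le hS z) u hun
  linarith

/-- Otherwise `T` stays away from zero along the weakly null sequence `x k - K (φ k) (x k)` with `x
k` nearly norming. -/
theorem IsCompactOperator.tendsto_comp {K : ℕ → X →L[𝕜] X}
    (hb : ∀ f : StrongDual 𝕜 X, Tendsto (fun n => f ∘L K n) atTop (𝓝 f))
    {T : X →L[𝕜] Y} (hT : IsCompactOperator T) : Tendsto (fun n => T ∘L K n) atTop (𝓝 T) := by
  rw [Metric.tendsto_atTop']
  by_contra! hcon
  obtain ⟨ε, hε, hcon⟩ := hcon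
  obtain ⟨φ, hφ, hlt⟩ := extraction_of_frequently_atTop
    (P := fun n => ε / 2 < ‖T - T ∘L K n‖) (frequently_atTop.2 fun N => by
      obtain ⟨n, hn, h⟩ := hcon N
      rw [dist_comm, dist_eq_norm] at h
      exact ⟨n, hn.le, by linarith⟩)
  choose x hx hxlt using fun k => ContinuousLinearMap.exists_lt_apply_of_lt_opNorm _ (hlt k)
  have h := (hT.tendsto_of_weaklyNull
    (weaklyNull_sub_apply hb (fun k => (hx k).le) hφ.tendsto_atTop)).norm
  rw [norm_zero] at h
  obtain ⟨k, hk⟩ := (h.eventually_lt_const (half_pos hε)).exists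
  have := hxlt k
  simp only [sub_apply, ContinuousLinearMap.comp_apply, map_sub] at this hk
  linarith

/-- The functionals on `L(X, Y)` that are continuous along `T ∘ K n → T`. -/
def continuousAlongSubmodule (U : Filter ℕ) (K : ℕ → X →L[𝕜] X) (Y : Type*)
    [NormedAddCommGroup Y] [NormedSpace 𝕜 Y] : Submodule 𝕜 (StrongDual 𝕜 (X →L[𝕜] Y)) where
  carrier := {g | ∀ T, Tendsto (fun n => g (T ∘L K n)) U (𝓝 (g T))}
  add_mem' hf hg T := (hf T).add (hg T)
  zero_mem' _ := tendsto_const_nhds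
  smul_mem' c _ hg T := (hg T).const_smul c

theorem isClosed_continuousAlongSubmodule (U : Filter ℕ) {K : ℕ → X →L[𝕜] X} {C : ℝ}
    (hC : ∀ n, ‖K n‖ ≤ C) :
    IsClosed (continuousAlongSubmodule U K Y : Set (StrongDual 𝕜 (X →L[𝕜] Y))) := by
  refine isClosed_of_closure_subset fun g hg T => ?_
  rw [Metric.tendsto_nhds]
  intro ε hε
  set M := ‖T‖ * C + ‖T‖ + 1 with hM
  have hC0 : 0 ≤ C := (norm_nonneg _).trans (hC 0)
  have hMpos : 0 < M := by positivity
  obtain ⟨f, hf, hfg⟩ := Metric.mem_closure_iff (α := StrongDual 𝕜 (X →L[𝕜] Y)).1 hg (ε / (2 * M)) (by positivity)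
  have hfg : ‖g - f‖ * (2 * M) < ε :=
    (lt_div_iff₀ (by positivity)).1 ((dist_eq_norm g f).symm.trans_lt hfg)
  filter_upwards [Metric.tendsto_nhds.1 (hf T) (ε / 2) (by positivity)] with n hn
  rw [dist_eq_norm] at hn ⊢
  have h1 : ‖(g - f) (T ∘L K n)‖ ≤ ‖g - f‖ * (‖T‖ * C) :=
    (g - f).le_opNorm_of_le ((T.opNorm_comp_le (K n)).trans (by gcongr; exact hC n))
  have h2 := (g - f).le_opNorm T
  have hid : g (T ∘L K n) - g T =
      (f (T ∘L K n) - f T) + ((g - f) (T ∘L K n) - (g - f) T) := by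
    simp only [sub_apply]
    abel
  rw [hid]
  have h3 := norm_add_le (f (T ∘L K n) - f T) ((g - f) (T ∘L K n) - (g - f) T)
  have h4 := norm_sub_le ((g - f) (T ∘L K n)) ((g - f) T)
  nlinarith [norm_nonneg (g - f)]

/-- This limit is the projection onto `V`: bounded scalars converge along an ultrafilter, and the
limits depend linearly on `T`. -/
theorem exists_ultrafilter_limit {U : Ultrafilter ℕ} {K : ℕ → X →L[𝕜] X} {C : ℝ}
    (hC : ∀ n, ‖K n‖ ≤ C) (φ : StrongDual 𝕜 (X →L[𝕜] Y)) :
    ∃ g : StrongDual 𝕜 (X →L[𝕜] Y), ∀ T, Tendsto (fun n => φ (T ∘L K n)) U (𝓝 (g T)) := by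
  have hbound (T : X →L[𝕜] Y) (n : ℕ) : ‖φ (T ∘L K n)‖ ≤ ‖φ‖ * C * ‖T‖ := by
    refine (φ.le_opNorm_of_le ((T.opNorm_comp_le (K n)).trans
      (mul_le_mul_of_nonneg_left (hC n) (norm_nonneg _)))).trans_eq (by ring)
  have hex (T : X →L[𝕜] Y) : ∃ a : 𝕜, Tendsto (fun n => φ (T ∘L K n)) U (𝓝 a) := by
    obtain ⟨a, -, ha⟩ := (isCompact_closedBall (0 : 𝕜) (‖φ‖ * C * ‖T‖)).ultrafilter_le_nhds
      (U.map fun n => φ (T ∘L K n))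
      (tendsto_principal.2 (.of_forall fun n => by simpa using hbound T n))
    exact ⟨a, ha⟩
  choose g hg using hex
  let g' : (X →L[𝕜] Y) →ₗ[𝕜] 𝕜 :=
    { toFun := g
      map_add' := fun S T => tendsto_nhds_unique (hg (S + T))
        (by simpa [ContinuousLinearMap.add_comp] using (hg S).add (hg T))
      map_smul' := fun c T => tendsto_nhds_unique (hg (c • T))
        (by simpa [ContinuousLinearMap.smul_comp] using (hg T).const_smul c) }
  exact ⟨g'.mkContinuous (‖φ‖ * C) fun T =>
    le_of_tendsto (hg T).norm (.of_forall (hbound T)), hg⟩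

theorem isMIdeal_compactOperator_of_hasAveragedM [CompleteSpace Y] {p : ℝ≥0∞} (hp : 1 ≤ p)
    {K : ℕ → X →L[𝕜] X} (hK : ∀ n, IsCompactOperator (K n))
    (ha : ∀ x : X, Tendsto (fun n => K n x) atTop (𝓝 x))
    (hb : ∀ f : StrongDual 𝕜 X, Tendsto (fun n => f ∘L K n) atTop (𝓝 f))
    (hc : Tendsto (fun n => ‖ContinuousLinearMap.id 𝕜 X - (2 : 𝕜) • K n‖) atTop (𝓝 1))
    (hT : ∀ T : X →L[𝕜] Y, ‖T‖ ≤ 1 → HasAveragedM p T) :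
    IsMIdeal (compactOperator (RingHom.id 𝕜) X Y) := by
  obtain ⟨C, hC⟩ := exists_norm_le_of_tendsto_norm_id_sub hc
  have hmem (T : X →L[𝕜] Y) (n : ℕ) : T ∘L K n ∈ compactOperator (RingHom.id 𝕜) X Y :=
    (hK n).clm_comp T
  set U : Ultrafilter ℕ := hyperfilter ℕ
  have hU : (U : Filter ℕ) ≤ atTop := Nat.hyperfilter_le_atTop
  refine ⟨isClosed_setOfPred_isCompactOperator, continuousAlongSubmodule U K Y,
    isClosed_continuousAlongSubmodule U hC, ⟨?_, ?_⟩, ?_⟩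
  · rw [Submodule.disjoint_def]
    intro g hg hgV
    rw [StrongDual.mem_polarSubmodule] at hg
    ext T
    have := hgV T
    simp only [hg _ (hmem T _)] at this
    exact tendsto_nhds_unique this tendsto_const_nhds
  · rw [codisjoint_iff, eq_top_iff]
    intro φ _
    obtain ⟨g, hg⟩ := exists_ultrafilter_limit (U := U) hC φ
    have heq : ∀ T ∈ compactOperator (RingHom.id 𝕜) X Y, g T = φ T := fun T hT =>
      tendsto_nhds_unique (hg T) (((φ.continuous.tendsto T).comp
        (IsCompactOperator.tendsto_comp hb hT)).mono_left hU)
    refine Submodule.mem_sup.2 ⟨φ - g, ?_, g, fun T => ?_, sub_add_cancel _ _⟩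
    · rw [StrongDual.mem_polarSubmodule]
      intro T hT
      simp [heq T hT]
    · simpa only [heq _ (hmem T _)] using hg T
  · intro f hf g hg
    rw [StrongDual.mem_polarSubmodule] at hf
    refine le_antisymm (norm_add_le _ _) (StrongDual.norm_add_norm_le fun S T hS hT1 => ?_)
    have hm (m : ℕ) {δ : ℝ} (hδ : 0 < δ) : ‖f T + g (S ∘L K m)‖ ≤
        ‖f + g‖ * ((1 + ‖ContinuousLinearMap.id 𝕜 X - (2 : 𝕜) • K m‖) / 2 + δ) := by
      -- `f` kills the compact operators `S ∘L K m` and `T ∘L K n`, and `g (T - T ∘L K n) → 0`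
      -- because `g ∈ V`.
      have h1 : Tendsto (fun n => (f + g) (S ∘L K m + (T - T ∘L K n))) U
          (𝓝 (f T + g (S ∘L K m))) := by
        have h2 := ((hg T).const_sub (g T)).const_add (f T + g (S ∘L K m))
        rw [sub_self, add_zero] at h2
        refine h2.congr fun n => ?_
        simp only [add_apply, map_add, map_sub, hf _ (hmem _ _)]
        ring
      refine le_of_tendsto h1.norm ?_
      filter_upwards [hU (eventually_norm_comp_add_comp_le hp hK ha hb hc hS (hT T hT1) m hδ)]
        with n hn using (f + g).le_opNorm_of_le hn
    -- Taking `δ = 1 / (m + 1)` and letting `m` grow uses (c) on the right and `g ∈ V` at `S` on the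
    -- left.
    have hlim : Tendsto (fun m : ℕ => ‖f + g‖ *
        ((1 + ‖ContinuousLinearMap.id 𝕜 X - (2 : 𝕜) • K m‖) / 2 + 1 / ((m : ℝ) + 1))) atTop
        (𝓝 ‖f + g‖) := by
      have := ((((hc.const_add 1).div_const 2).add
        tendsto_one_div_add_atTop_nhds_zero_nat).const_mul ‖f + g‖)
      norm_num at this
      simpa using this
    exact le_of_tendsto_of_tendsto' ((hg S).const_add (f T)).norm (hlim.mono_left hU)
      fun m => hm m (by positivity)

end Sufficiency

theorem proposition3p77 {𝕜 X Y : Type*} [RCLike 𝕜]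
    [NormedAddCommGroup X] [NormedSpace 𝕜 X] [CompleteSpace X]
    [NormedAddCommGroup Y] [NormedSpace 𝕜 Y] [CompleteSpace Y]
    (p : ℝ≥0∞) (hp : 1 ≤ p)
    (K : ℕ → X →L[𝕜] X) (hK : ∀ n, IsCompactOperator (K n))
    (ha : ∀ x : X, Tendsto (fun n => K n x) atTop (𝓝 x))
    (hb : ∀ f : StrongDual 𝕜 X, Tendsto (fun n => f ∘L K n) atTop (𝓝 f))
    (hc : Tendsto (fun n => ‖ContinuousLinearMap.id 𝕜 X - (2 : 𝕜) • K n‖) atTop (𝓝 1)) :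
    IsMIdeal (compactOperator (RingHom.id 𝕜) X Y) ↔
      ∀ T : X →L[𝕜] Y, ‖T‖ ≤ 1 → HasAveragedM p T :=
  ⟨fun hM _ => hM.hasAveragedM hp, isMIdeal_compactOperator_of_hasAveragedM hp hK ha hb hc⟩
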